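/- Let $\mathbb{F}_q$ be the finite field with $q$ elements, of characteristic $p$, let $c \in \mathbb{F}_q \setminus \{0\}$, and let $d > 1$ be an integer with $\gcd(d, q-1) = 1$ and $p \nmid d$. For a function $F : \mathbb{F}_q \to \mathbb{F}_q$, the $c$-boomerang uniformity of $F$ is $$\beta_{F,c} = \max_{a, b \in \mathbb{F}_q \setminus \{0\}} \left| \left\{ (x,y) \in \mathbb{F}_q^2 \;\middle|\; F(x+y) - c\,F(x) = b \ \text{ and } \ c\,F(x+y+a) - F(x+a) = c\,b \right\} \right|.$$ The map $x \mapsto x^d$ is a permutation of $\mathbb{F}_q$; let $x^{1/d}$ denote its compositional inverse. Then 1. $\beta_{x^d, c} \leq d^2$; 2. $\beta_{x^{1/d}, c} \leq d^2$. -/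

import Mathlib

/-- The entry at `(a, b)` of the `c`-Boomerang Connectivity Table of a function `F` between
finite vector spaces over a field `K` (such as `V = Kⁿ`, `W = Kᵐ`, or `V = W = K`): the number of
pairs `(x, y)` with `F (x + y) - c F x = b` and `c F (x + y + a) - F (x + a) = c b`. -/
def boomerangEntry {K V W : Type*} [Field K] [AddCommGroup V] [AddCommGroup W] [Module K V]
    [Module K W] [Fintype V] [DecidableEq W]
    (c : K) (F : V → W) (a : V) (b : W) : ℕ :=
  (Finset.univ.filter fun xy : V × V =>
    F (xy.1 + xy.2) - c • F xy.1 = b ∧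
      c • F (xy.1 + xy.2 + a) - F (xy.1 + a) = c • b).card

/-- The `c`-boomerang uniformity of `F`: the largest entry of its `c`-Boomerang Connectivity
Table at a pair `(a, b)` with `a ≠ 0` and `b ≠ 0`. -/
def boomerangUniformity {K V W : Type*} [Field K] [AddCommGroup V] [AddCommGroup W] [Module K V]
    [Module K W] [Fintype V] [Fintype W] [DecidableEq V] [DecidableEq W]
    (c : K) (F : V → W) : ℕ :=
  (Finset.univ.filter fun ab : V × W => ab.1 ≠ 0 ∧ ab.2 ≠ 0).sup fun ab =>
    boomerangEntry c F ab.1 ab.2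

/-- If `d > 1` is coprime to `q - 1`, then `x ↦ x ^ d` permutes the field with `q` elements. -/
theorem pow_bijective_of_coprime {K : Type*} [Field K] [Fintype K] {d : ℕ} (hd : 1 < d)
    (hcop : Nat.gcd d (Fintype.card K - 1) = 1) :
    Function.Bijective fun x : K => x ^ d := by
  classical
  refine Finite.injective_iff_bijective.mp fun x y hxy => ?_
  have hd0 : d ≠ 0 := by omega
  change x ^ d = y ^ d at hxy
  by_cases hx : x = 0
  · subst hx
    rw [zero_pow hd0] at hxy
    exact (pow_eq_zero_iff hd0 |>.mp hxy.symm).symm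
  · have hy : y ≠ 0 := by
      rintro rfl
      rw [zero_pow hd0] at hxy
      exact hx (pow_eq_zero_iff hd0 |>.mp hxy)
    have hc : (Nat.card Kˣ).Coprime d := by
      rw [Nat.card_eq_fintype_card, Fintype.card_units]
      exact Nat.Coprime.symm hcop
    have h : Units.mk0 x hx ^ d = Units.mk0 y hy ^ d := by
      ext
      simpa using hxy
    have h2 := (powCoprime hc).injective (a₁ := Units.mk0 x hx) (a₂ := Units.mk0 y hy) h
    simpa using congrArg Units.val h2

/-- The permutation monomial `x ↦ x ^ d` of the field with `q` elements, `gcd (d, q - 1) = 1`.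
Its compositional inverse `x ^ (1 / d)` is `(powerPerm hd hcop).symm`. -/
noncomputable def powerPerm {K : Type*} [Field K] [Fintype K] {d : ℕ} (hd : 1 < d)
    (hcop : Nat.gcd d (Fintype.card K - 1) = 1) : Equiv.Perm K :=
  Equiv.ofBijective (fun x : K => x ^ d) (pow_bijective_of_coprime hd hcop)

/-! A change of variables embeds the solutions of each boomerang system into the common points of
two plane curves of degree at most `d`, with equations `f` and `g`. The curve `f` is irreducible by
Eisenstein and does not divide `g`, so the two are coprime, and Bézout's bound, proved by counting
dimensions, gives `d ^ 2`. -/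

open MvPolynomial in
theorem MvPolynomial.finrank_restrictTotalDegree_fin_two (K : Type*) [Field K] (n : ℕ) :
    2 * Module.finrank K (restrictTotalDegree (Fin 2) K n) = (n + 1) * (n + 2) := by
  have e : {s : Fin 2 →₀ ℕ | (s.sum fun _ k => k) ≤ n} ≃ Σ i : Fin (n + 1), Fin (i + 1) :=
    { toFun := fun s => ⟨⟨s.1 0 + s.1 1, by
          have := s.2
          simp [Finsupp.sum_fintype, Fin.sum_univ_two] at this
          omega⟩, ⟨s.1 0, by simp⟩⟩
      invFun := fun x => ⟨Finsupp.equivFunOnFinite.symm ![x.2, x.1 - x.2], by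
          have := x.1.2
          have := x.2.2
          simp [Finsupp.sum_fintype, Fin.sum_univ_two]
          omega⟩
      left_inv := fun s => by
        ext i
        fin_cases i <;> simp
      right_inv := fun ⟨i, j⟩ => by
        have := j.2
        refine Sigma.ext (Fin.ext ?_) ((Fin.heq_ext_iff ?_).mpr ?_) <;> simp <;> omega }
  have h : Module.finrank K (restrictTotalDegree (Fin 2) K n) = ∑ i : Fin (n + 1), ((i : ℕ) + 1) := by
    rw [restrictTotalDegree, Module.finrank_eq_nat_card_basis (basisRestrictSupport K _),
      Nat.card_congr e]
    simp
  have hs := Finset.sum_range_id_mul_two (n + 2)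
  rw [Finset.sum_range_succ', add_zero] at hs
  rw [h, Fin.sum_univ_eq_sum_range (fun i => i + 1) (n + 1), mul_comm, hs]
  exact mul_comm _ _

open MvPolynomial in
/-- **Bézout's bound**: two coprime plane curves over a finite field have at most
`deg f * deg g` common rational points. -/
theorem MvPolynomial.card_common_zeros_le_of_isRelPrime {K : Type*} [Field K] [Fintype K]
    {f g : MvPolynomial (Fin 2) K} (hf : f ≠ 0) (hfg : IsRelPrime f g)
    (S : Finset (Fin 2 → K)) (hSf : ∀ x ∈ S, eval x f = 0) (hSg : ∀ x ∈ S, eval x g = 0) :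
    S.card ≤ f.totalDegree * g.totalDegree := by
  set d := f.totalDegree with hd
  set e := g.totalDegree with he
  -- Polynomials of degree at most `q - 1` in each variable interpolate every function on the plane;
  -- their total degree is at most `k`.
  set k := 2 * (Fintype.card K - 1) with hk
  let V := restrictTotalDegree (Fin 2) K
  have mem : ∀ {m n l : ℕ} (p q : MvPolynomial (Fin 2) K), p.totalDegree ≤ m → q ∈ V n →
      m + n = l → p * q ∈ V l := by
    intro m n l p q hp hq hl
    rw [mem_restrictTotalDegree] at hq ⊢
    exact (totalDegree_mul p q).trans (by omega)
  let mulBy (p : MvPolynomial (Fin 2) K) {m n l : ℕ} (hp : p.totalDegree ≤ m) (hl : m + n = l) :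
      V n →ₗ[K] V l :=
    ((LinearMap.mulLeft K p).comp (V n).subtype).codRestrict (V l) fun q => mem p q hp q.2 hl
  have mulBy_coe (p : MvPolynomial (Fin 2) K) {m n l : ℕ} (hp : p.totalDegree ≤ m)
      (hl : m + n = l) (q : V n) : (mulBy p hp hl q : MvPolynomial (Fin 2) K) = p * q := rfl
  let Φ : V (e + k) × V (d + k) →ₗ[K] V (d + e + k) :=
    (mulBy f le_rfl (by omega)).coprod (mulBy g le_rfl (by omega))
  let Ψ : V k →ₗ[K] V (e + k) × V (d + k) :=
    (mulBy g le_rfl rfl).prod (-mulBy f le_rfl rfl)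
  -- By coprimality, the only syzygies of `(f, g)` are multiples of `(g, -f)`.
  have hker : LinearMap.ker Φ ≤ LinearMap.range Ψ := by
    rintro ⟨P, Q⟩ hPQ
    have h : f * P.1 + g * Q.1 = 0 := congrArg Subtype.val (LinearMap.mem_ker.mp hPQ)
    obtain ⟨R, hR⟩ : f ∣ Q.1 := hfg.dvd_of_dvd_mul_left ⟨-P.1, by linear_combination h⟩
    have hP : P.1 = g * -R := mul_left_cancel₀ hf (by rw [hR] at h; linear_combination h)
    have hRk : -R ∈ V k := by
      rw [mem_restrictTotalDegree, totalDegree_neg]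
      by_cases hR0 : R = 0
      · simp [hR0]
      have := (mem_restrictTotalDegree _ _ _).mp Q.2
      rw [hR, totalDegree_mul_of_isDomain hf hR0] at this
      omega
    refine ⟨⟨-R, hRk⟩, Prod.ext (Subtype.ext hP.symm) (Subtype.ext ?_)⟩
    change -(f * -R) = Q.1
    rw [hR]; ring
  let ev : V (d + e + k) →ₗ[K] (S → K) :=
    (LinearMap.funLeft K K (Subtype.val : S → Fin 2 → K)).comp
      ((evalₗ K (Fin 2)).comp (V (d + e + k)).subtype)
  have hev : Function.Surjective ev := by
    intro y
    obtain ⟨z, hz⟩ := LinearMap.funLeft_surjective_of_injective K K (Subtype.val : S → Fin 2 → K)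
      Subtype.val_injective y
    have hz' : z ∈ (restrictDegree (Fin 2) K (Fintype.card K - 1)).map (evalₗ K (Fin 2)) := by
      rw [map_restrict_dom_evalₗ]; trivial
    obtain ⟨p, hp, rfl⟩ := hz'
    refine ⟨⟨p, ?_⟩, hz⟩
    rw [mem_restrictTotalDegree, totalDegree, Finset.sup_le_iff]
    intro s hs
    have := (mem_restrictDegree _ p _).mp hp s hs
    have h0 := this 0
    have h1 := this 1
    rw [Finsupp.sum_fintype _ _ (fun _ => rfl), Fin.sum_univ_two]
    omega
  have hrange : LinearMap.range Φ ≤ LinearMap.ker ev := by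
    rintro _ ⟨⟨P, Q⟩, rfl⟩
    rw [LinearMap.mem_ker]
    ext x
    change eval x.1 (f * P.1 + g * Q.1) = 0
    rw [map_add, map_mul, map_mul, hSf x.1 x.2, hSg x.1 x.2, zero_mul, zero_mul, add_zero]
  have h1 := Φ.finrank_range_add_finrank_ker
  have h2 := ev.finrank_range_add_finrank_ker
  rw [LinearMap.range_eq_top.mpr hev, finrank_top, Module.finrank_fintype_fun_eq_card,
    Fintype.card_coe] at h2
  rw [Module.finrank_prod] at h1
  have h3 := Submodule.finrank_mono hker
  have h4 := Submodule.finrank_mono hrange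
  have h5 := LinearMap.finrank_range_le Ψ
  have hV (n : ℕ) : 2 * Module.finrank K (V n) = (n + 1) * (n + 2) :=
    finrank_restrictTotalDegree_fin_two K n
  have t1 := hV k
  have t2 := hV (e + k)
  have t3 := hV (d + k)
  have t4 := hV (d + e + k)
  -- `S.card ≤ dim V (d+e+k) - dim V (e+k) - dim V (d+k) + dim V k = d * e`.
  nlinarith

open MvPolynomial in
/-- The curve `u ^ d = c * v ^ d + b` is irreducible. -/
theorem MvPolynomial.irreducible_X_pow_sub_C_mul_X_pow_sub_C {K : Type*} [Field K] {b c : K}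
    (hb : b ≠ 0) (hc : c ≠ 0) {d : ℕ} (hd : (d : K) ≠ 0) :
    Irreducible (X 0 ^ d - C c * X 1 ^ d - C b : MvPolynomial (Fin 2) K) := by
  have hd0 : d ≠ 0 := by rintro rfl; simp at hd
  set h : MvPolynomial (Fin 1) K := C c * X 0 ^ d + C b with hh
  have hnu : ¬ IsUnit h := by
    intro hu
    have h1 := hu.map (aeval (fun _ => (Polynomial.X : Polynomial K)))
    have h2 := Polynomial.natDegree_eq_zero_of_isUnit h1
    simp only [hh, map_add, map_mul, map_pow, aeval_C, aeval_X, Polynomial.algebraMap_eq] at h2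
    rw [Polynomial.natDegree_add_C, Polynomial.natDegree_C_mul_X_pow d c hc] at h2
    exact hd0 h2
  have h0 : h ≠ 0 := by
    intro h0
    have h1 : eval 0 h = 0 := by rw [h0, map_zero]
    simp [hh, hd0, hb] at h1
  obtain ⟨π, hπ, hπh⟩ := WfDvdMonoid.exists_irreducible_factor hnu h0
  -- A double factor would divide `d * h - X * h' = d * b`, a nonzero constant.
  have hsq : ¬ π ^ 2 ∣ h := by
    rintro ⟨r, hr⟩
    have hder : pderiv 0 h = C (c * d) * X 0 ^ (d - 1) := by
      simp [hh, mul_assoc]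
    have hder' : π ∣ pderiv 0 h := by
      rw [hr, Derivation.leibniz, Derivation.leibniz_pow]
      exact ⟨π * pderiv 0 r + 2 * r * pderiv 0 π, by simp [smul_eq_mul]; ring⟩
    have hpow : (X 0 : MvPolynomial (Fin 1) K) ^ d = X 0 ^ (d - 1) * X 0 := by
      rw [← pow_succ, Nat.sub_add_cancel (Nat.pos_of_ne_zero hd0)]
    have hdb : π ∣ C (d * b) := by
      have h3 := dvd_sub (hπh.mul_left (C (d : K))) (hder'.mul_right (X 0))
      convert h3 using 1
      rw [hder, hh, hpow]
      simp only [map_mul]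
      ring
    exact hπ.not_isUnit (isUnit_of_dvd_unit hdb
      (((isUnit_iff_ne_zero.mpr (mul_ne_zero hd hb))).map C))
  have himg : finSuccEquiv K 1 (X 0 ^ d - C c * X 1 ^ d - C b) =
      Polynomial.X ^ d - Polynomial.C h := by
    have h1 : finSuccEquiv K 1 (X 1) = Polynomial.C (X 0) := finSuccEquiv_X_succ (j := 0)
    have hC : ∀ r : K, finSuccEquiv K 1 (C r) = Polynomial.C (C r) := fun r => by
      simp [finSuccEquiv_apply]
    simp only [map_sub, map_mul, map_pow, finSuccEquiv_X_zero, h1, hC, hh, map_add]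
    ring
  rw [← MulEquiv.irreducible_iff (finSuccEquiv K 1), himg]
  have hmonic := Polynomial.monic_X_pow_sub_C h hd0
  have hprime : (Ideal.span {π}).IsPrime :=
    (Ideal.span_singleton_prime hπ.ne_zero).mpr hπ.prime
  refine Polynomial.irreducible_of_eisenstein_criterion hprime ?_ ?_ ?_ ?_ hmonic.isPrimitive
  · rw [hmonic.leadingCoeff]
    exact hprime.one_notMem
  · intro n hn
    rw [Polynomial.degree_X_pow_sub_C (Nat.pos_of_ne_zero hd0), Nat.cast_lt] at hn
    rw [Polynomial.coeff_sub, Polynomial.coeff_X_pow, if_neg hn.ne, zero_sub, neg_mem_iff,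
      Polynomial.coeff_C]
    split_ifs
    · exact Ideal.mem_span_singleton.mpr hπh
    · exact zero_mem _
  · rw [Polynomial.degree_X_pow_sub_C (Nat.pos_of_ne_zero hd0)]
    exact_mod_cast Nat.pos_of_ne_zero hd0
  · rw [Ideal.span_singleton_pow, Ideal.mem_span_singleton]
    simpa [Polynomial.coeff_X_pow, hd0.symm] using hsq

open MvPolynomial in
/-- The curves `u ^ d = c * v ^ d + b` and `e * (u + a) ^ d = e' * (v + a') ^ d + k` meet in at
most `d ^ 2` rational points. -/
theorem card_common_solutions_le_sq {K : Type*} [Field K] [Fintype K] [DecidableEq K]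
    {a b c e : K} (a' e' k : K) (ha : a ≠ 0) (hb : b ≠ 0) (hc : c ≠ 0) (he : e ≠ 0)
    {d : ℕ} (hd1 : 1 < d) (hd : (d : K) ≠ 0) :
    (Finset.univ.filter fun uv : K × K => uv.1 ^ d - c * uv.2 ^ d = b ∧
      e * (uv.1 + a) ^ d - e' * (uv.2 + a') ^ d = k).card ≤ d ^ 2 := by
  set f : MvPolynomial (Fin 2) K := X 0 ^ d - C c * X 1 ^ d - C b with hf
  set g : MvPolynomial (Fin 2) K :=
    C e * (X 0 + C a) ^ d - C e' * (X 1 + C a') ^ d - C k with hg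
  have hirr : Irreducible f := irreducible_X_pow_sub_C_mul_X_pow_sub_C hb hc hd
  have hlin (i : Fin 2) (r s : K) : (C s * (X i + C r) ^ d).totalDegree ≤ d := by
    refine (totalDegree_mul _ _).trans ?_
    rw [totalDegree_C, zero_add]
    refine (totalDegree_pow _ _).trans ((Nat.mul_le_mul_left d ?_).trans_eq (mul_one d))
    exact (totalDegree_add _ _).trans (by simp)
  have hgd : g.totalDegree ≤ d :=
    (totalDegree_sub _ _).trans (max_le ((totalDegree_sub _ _).trans
      (max_le (hlin 0 a e) (hlin 1 a' e'))) (by simp))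
  have hfd : f.totalDegree ≤ d :=
    (totalDegree_sub _ _).trans (max_le ((totalDegree_sub _ _).trans
      (max_le (by simp) (by simpa using hlin 1 0 c))) (by simp))
  have hfd' : d ≤ f.totalDegree := by
    have hmem : Finsupp.single 0 d ∈ f.support := by
      rw [mem_support_iff]
      simp [hf, coeff_C_mul, coeff_X_pow, coeff_C, Finsupp.single_eq_single_iff,
        show d ≠ 0 by omega, eq_comm (a := (0 : Fin 2 →₀ ℕ))]
    simpa using le_totalDegree hmem
  have hndvd : ¬ f ∣ g := by
    rintro ⟨R, hR⟩
    obtain ⟨r, rfl⟩ : ∃ r, R = C r := by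
      by_cases hR0 : R = 0
      · exact ⟨0, by simp [hR0]⟩
      have h1 := totalDegree_mul_of_isDomain hirr.ne_zero hR0
      rw [← hR] at h1
      exact ⟨_, totalDegree_eq_zero_iff_eq_C.mp (by omega)⟩
    set φ := aeval (R := K) ![(Polynomial.X : Polynomial K), 0] with hφ
    have hφf : φ f = Polynomial.X ^ d - Polynomial.C b := by
      simp [hφ, hf, show d ≠ 0 by omega]
    have hφg : φ g = Polynomial.C e * (Polynomial.X + Polynomial.C a) ^ d -
        Polynomial.C (e' * a' ^ d + k) := by
      simp [hφ, hg]
      ring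
    have hφr : φ (C r) = Polynomial.C r := by simp [hφ]
    -- On the line `v = 0`, the coefficient of degree `d - 1` is `e * d * a ≠ 0` for `g` but `0` for
    -- `f * C r`, as `0 < d - 1 < d`.
    have h1 := congrArg (fun p => (φ p).coeff (d - 1)) hR
    have h2 : ¬ (d - 1 = d) := by omega
    have h3 : ¬ (d - 1 = 0) := by omega
    simp only [map_mul, hφf, hφg, hφr, Polynomial.coeff_sub,
      Polynomial.coeff_C_mul, Polynomial.coeff_mul_C, Polynomial.coeff_X_add_C_pow,
      Polynomial.coeff_C, Polynomial.coeff_X_pow, if_neg h2, if_neg h3, sub_zero, zero_mul] at h1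
    rw [show d - (d - 1) = 1 by omega, Nat.choose_symm_of_eq_add (b := 1) (by omega)] at h1
    simp [ha, hd, he] at h1
  have hrel : IsRelPrime f g := (hirr.isRelPrime_iff_not_dvd).mpr hndvd
  rw [← Finset.card_map (finTwoArrowEquiv K).symm.toEmbedding]
  refine (card_common_zeros_le_of_isRelPrime hirr.ne_zero hrel _ ?_ ?_).trans
    ((Nat.mul_le_mul hfd hgd).trans_eq (sq d).symm)
  all_goals
    intro x hx
    obtain ⟨⟨u, v⟩, huv, rfl⟩ := Finset.mem_map.mp hx
    obtain ⟨h1, h2⟩ := (Finset.mem_filter.mp huv).2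
    simp only [Equiv.coe_toEmbedding, finTwoArrowEquiv_symm_apply]
  · simpa [hf, sub_eq_zero] using h1
  · simpa [hg, sub_eq_zero] using h2

theorem mainTheorem1 {K : Type*} [Field K] [Fintype K] [DecidableEq K] (p : ℕ) [CharP K p]
    (c : K) (hc : c ≠ 0) (d : ℕ) (hd : 1 < d)
    (hcop : Nat.gcd d (Fintype.card K - 1) = 1) (hpd : ¬ p ∣ d) :
    boomerangUniformity c (fun x : K => x ^ d) ≤ d ^ 2 ∧
      boomerangUniformity c (powerPerm (K := K) hd hcop).symm ≤ d ^ 2 := by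
  have hdK : (d : K) ≠ 0 := fun h => hpd ((CharP.cast_eq_zero_iff K p d).mp h)
  constructor
  · refine Finset.sup_le fun ab hab => ?_
    obtain ⟨ha, hb⟩ := (Finset.mem_filter.mp hab).2
    refine le_trans (Finset.card_le_card_of_injOn (fun xy => (xy.1 + xy.2, xy.1)) ?_ ?_)
      (card_common_solutions_le_sq ab.1 1 (c * ab.2) ha hb hc hc hd hdK)
    · rintro ⟨x, y⟩ hxy
      simpa using hxy
    · rintro ⟨x, y⟩ - ⟨x', y'⟩ - h
      simp only [Prod.mk.injEq] at h
      obtain ⟨h1, rfl⟩ := h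
      simpa using h1
  · refine Finset.sup_le fun ab hab => ?_
    obtain ⟨ha, hb⟩ := (Finset.mem_filter.mp hab).2
    obtain ⟨a, b⟩ := ab
    set G := (powerPerm (K := K) hd hcop).symm with hG
    have hpow (x : K) : G x ^ d = x := (powerPerm (K := K) hd hcop).apply_symm_apply x
    have hcd : c ^ d ≠ 0 := pow_ne_zero _ hc
    have hcinv : c⁻¹ ≠ 0 := inv_ne_zero hc
    -- With `u = G (x + y + a)` and `v = G (x + y)`, the system reads `c * (u - b) = G (x + a)` and
    -- `c⁻¹ * (v - b) = G x`. Taking `d`-th powers, both curves express a difference equal to `a`: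
    -- `(x + y + a) - (x + y)` and `(x + a) - x`.
    refine le_trans (Finset.card_le_card_of_injOn
      (fun xy => (G (xy.1 + xy.2 + a), G (xy.1 + xy.2))) ?_ ?_)
      (card_common_solutions_le_sq (-b) (c⁻¹ ^ d) a (neg_ne_zero.mpr hb) ha one_ne_zero hcd hd hdK)
    · rintro ⟨x, y⟩ hxy
      obtain ⟨h1, h2⟩ : G (x + y) - c * G x = b ∧ c * G (x + y + a) - G (x + a) = c * b := by
        simpa using hxy
      have h3 : c * (G (x + y + a) + -b) = G (x + a) := by linear_combination h2
      have h4 : c⁻¹ * (G (x + y) + -b) = G x := by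
        rw [inv_mul_eq_iff_eq_mul₀ hc]; linear_combination h1
      simp [← mul_pow, h3, h4, hpow, -inv_pow]
    · rintro ⟨x, y⟩ hxy ⟨x', y'⟩ hxy' h
      obtain ⟨h1, -⟩ : G (x + y) - c * G x = b ∧ _ := by simpa using hxy
      obtain ⟨h1', -⟩ : G (x' + y') - c * G x' = b ∧ _ := by simpa using hxy'
      have h2 : G (x + y) = G (x' + y') := congrArg Prod.snd h
      have h3 : x = x' := G.injective (mul_left_cancel₀ hc (by linear_combination h1' - h1 + h2))
      have h4 : x + y = x' + y' := G.injective h2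
      subst h3
      simpa using h4
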